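/- Let $U_1,U_2,\ldots$ be i.i.d. random variables with the uniform distribution $\mathcal U(0,1)$, and let $\mathbb H=L^2((0,1),\mathcal B,\mathrm dt)$ with norm $\|f\|_{\mathbb H}=\bigl(\int_0^1 f(t)^2\,\mathrm dt\bigr)^{1/2}$. For $n\ge 1$ define the random element $\widehat Z_n$ of $\mathbb H$ by $$\widehat Z_n(t)=\frac1{\sqrt n}\sum_{j=1}^n(2U_j-1)\mathbf 1\{U_j\ge t\}-\sqrt n\,t(1-t),\quad 0<t<1,$$ and let $$T_n=n\int_0^1\Bigl|\frac1n\sum_{j=1}^n(2U_j-1)\mathbf 1\{U_j\ge t\}-t(1-t)\Bigr|^2\mathrm dt=\|\widehat Z_n\|_{\mathbb H}^2 .$$ Then there exists a centred Gaussian random element $Z$ of $\mathbb H$ with covariance kernel $$K_Z(s,t)=\frac{1-(2\max(s,t)-1)^3}{6}-st(1-s)(1-t),\quad s,t\in(0,1),$$ that is, $\operatorname{Cov}(\langle f,Z\rangle_{\mathbb H},\langle g,Z\rangle_{\mathbb H})=\int_0^1\int_0^1K_Z(s,t)f(s)g(t)\,\mathrm dt\,\mathrm ds$ for all $f,g\in\mathbb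 H$, such that, as $n\to\infty$: (a) $\widehat Z_n$ converges in distribution to $Z$ in $\mathbb H$; (b) $T_n$ converges in distribution to $\|Z\|_{\mathbb H}^2$. -/

import Mathlib

open MeasureTheory ProbabilityTheory Filter Set
open scoped Topology

noncomputable section

/-- Lebesgue measure on the open unit interval `(0,1)`, as a measure on `ℝ`. -/
abbrev unitMeasure : Measure ℝ := volume.restrict (Ioo (0 : ℝ) 1)

/-- The separable real Hilbert space `L²((0,1), ℬ, dt)`. -/
abbrev L2Unit : Type := Lp ℝ 2 unitMeasure

/-- `L²(0,1)` carries the Borel `σ`-algebra of its norm topology. -/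
instance L2Unit.instMeasurableSpace : MeasurableSpace L2Unit := borel L2Unit

instance L2Unit.instBorelSpace : BorelSpace L2Unit := ⟨rfl⟩

/-- The function `t ↦ n^{-1/2} ∑_{j ≤ n} (2 u_j - 1) 1{u_j ≥ t} - √n t (1 - t)`,
where the first `n` terms of the sequence are `u 0, …, u (n - 1)`. -/
def zHatFun (u : ℕ → ℝ) (n : ℕ) (t : ℝ) : ℝ :=
  (Real.sqrt n)⁻¹ * ∑ j ∈ Finset.range n, (2 * u j - 1) * (if t ≤ u j then 1 else 0)
    - Real.sqrt n * (t * (1 - t))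

theorem memLp_zHatFun (u : ℕ → ℝ) (n : ℕ) : MemLp (zHatFun u n) 2 unitMeasure := by
  have hpoly : MemLp (fun t : ℝ => t * (1 - t)) 2 unitMeasure := by
    refine MemLp.of_bound (by fun_prop) 1 ?_
    filter_upwards [ae_restrict_mem measurableSet_Ioo] with t ht
    rw [Real.norm_eq_abs, abs_le]
    constructor <;> nlinarith [ht.1, ht.2]
  have hind : ∀ j, MemLp (fun t : ℝ => (if t ≤ u j then (1 : ℝ) else 0)) 2 unitMeasure := by
    intro j
    refine MemLp.of_bound (Measurable.ite measurableSet_Iic measurable_const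
      measurable_const).aestronglyMeasurable 1 (ae_of_all _ fun t => ?_)
    split_ifs <;> simp
  exact ((memLp_finsetSum _ fun j _ => (hind j).const_mul (2 * u j - 1)).const_mul _).sub
    (hpoly.const_mul _)

/-- The element of `L²(0,1)` represented by `zHatFun u n`. -/
def zHat (u : ℕ → ℝ) (n : ℕ) : L2Unit := (memLp_zHatFun u n).toLp (zHatFun u n)

/-- The test statistic
`T_n = n ∫₀¹ |(1/n) ∑_{j ≤ n} (2 u_j - 1) 1{u_j ≥ t} - t (1 - t)|² dt`. -/
def tStat (u : ℕ → ℝ) (n : ℕ) : ℝ :=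
  n * ∫ t in Ioo (0 : ℝ) 1,
    |1 / (n : ℝ) * ∑ j ∈ Finset.range n, (2 * u j - 1) * (if t ≤ u j then 1 else 0)
      - t * (1 - t)| ^ 2

/-- The covariance kernel `K_Z`. -/
def kernelZ (s t : ℝ) : ℝ :=
  (1 - (2 * max s t - 1) ^ 3) / 6 - s * t * (1 - s) * (1 - t)

/-- `Z` is a centred Gaussian random element of `L²(0,1)` with covariance kernel `K`: its law is
Gaussian, its mean is `0`, and its covariance operator is the integral operator with kernel `K`,
that is `Cov(⟨f, Z⟩, ⟨g, Z⟩) = ∫₀¹ ∫₀¹ K(s,t) f(s) g(t) dt ds` for all `f, g`. -/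
structure IsCentredGaussianElement {Ω : Type*} [MeasurableSpace Ω] (Z : Ω → L2Unit)
    (P : Measure Ω) (K : ℝ → ℝ → ℝ) : Prop where
  hasGaussianLaw : HasGaussianLaw Z P
  mean_eq_zero : ∫ ω, Z ω ∂P = 0
  covariance_eq : ∀ f g : L2Unit,
    covariance (fun ω => inner ℝ f (Z ω)) (fun ω => inner ℝ g (Z ω)) P =
      ∫ s in Ioo (0 : ℝ) 1, ∫ t in Ioo (0 : ℝ) 1, K s t * f s * g t

end

/-!
The functions `ξ_u : t ↦ (2 u - 1) 1{u ≥ t} - t (1 - t)` are bounded by `2` on the unit square, and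
`zHat` is `n^{-1/2} ∑ ξ_{U_j}`: since `∫₀¹ ξ_u(t) du = 0`, it is a normalised sum of i.i.d. centred
square-integrable elements of `L²(0,1)`. The convergence is thus an instance of the central limit
theorem in a separable Hilbert space, `exists_isGaussian_tendstoInDistribution_inv_sqrt_smul_sum`,
and the limiting covariance is that of a single summand, which Fubini's theorem turns into the
integral operator with kernel `∫₀¹ ξ_u(s) ξ_u(t) du = kernelZ s t`
(`covarianceBilin_map_centredSummandLp`). The statement about `tStat` follows from the continuity
of `‖·‖²`.

The Hilbert space theorem rests on two facts.

* Tightness (`isTightMeasureSet_map_inv_sqrt_smul_sum`). Independence gives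
  `E‖L S_n‖² ≤ E‖L X₀‖²` for the normalised sums `S_n` and every bounded operator `L`. Taking for
  `L` the identity and the projections orthogonal to finite-dimensional subspaces, Chebyshev's
  inequality shows that, uniformly in `n`, `S_n` is with high probability close to a ball of a
  finite-dimensional subspace; completeness turns this into tightness. A suitable subspace is
  spanned by the values of a simple function close to `X₀` in `L²`.
* Convergence of characteristic functions (`tendsto_charFun_map_inv_sqrt_smul_sum`), which is the
  one-dimensional central limit theorem applied to `⟪t, X_k⟫`.

By Prokhorov's theorem the laws of `S_n` have a cluster point; its characteristic function is the
limiting one, so the limit law exists, is Gaussian, and attracts the whole sequence. In particular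
the Gaussian element is obtained from the limit theorem itself, with no separate construction.
-/

open scoped ENNReal RealInnerProductSpace

/-! ### Tightness in complete metric and Hilbert spaces -/

/-- In a complete space, mass concentrated near a compact set, at every scale and up to every `ε`,
is mass concentrated on a compact set: intersect countably many closed thickenings of radii
tending to `0`. -/
theorem isTightMeasureSet_of_forall_exists_measure_compl_cthickening_le {E : Type*}
    [PseudoMetricSpace E] [CompleteSpace E] [MeasurableSpace E] {S : Set (Measure E)}
    (h : ∀ ε : ℝ≥0∞, 0 < ε → ∀ η : ℝ, 0 < η →
      ∃ C : Set E, IsCompact C ∧ ∀ μ ∈ S, μ (Metric.cthickening η C)ᶜ ≤ ε) :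
    IsTightMeasureSet S := by
  rw [isTightMeasureSet_iff_exists_isCompact_measure_compl_le]
  intro ε hε
  obtain ⟨ε', hε', hsum⟩ := ENNReal.exists_pos_sum_of_countable' hε.ne' ℕ
  choose C hC hμ using fun m : ℕ => h (ε' m) (hε' m) (1 / ((m : ℝ) + 1)) (by positivity)
  refine ⟨⋂ m : ℕ, Metric.cthickening (1 / ((m : ℝ) + 1)) (C m), ?_, fun μ hμS => ?_⟩
  · refine (Metric.totallyBounded_iff.2 fun r hr => ?_).isCompact_of_isClosed
      (isClosed_iInter fun m => Metric.isClosed_cthickening)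
    obtain ⟨m, hm⟩ := exists_nat_one_div_lt (half_pos hr)
    obtain ⟨t, ht, hCt⟩ := Metric.totallyBounded_iff.1 (hC m).totallyBounded _ (half_pos hr)
    refine ⟨t, ht, fun x hx => ?_⟩
    obtain ⟨z, hz, hxz⟩ := Metric.mem_thickening_iff.1
      (Metric.cthickening_subset_thickening' (half_pos hr) hm _ (mem_iInter.1 hx m))
    obtain ⟨y, hy, hzy⟩ := mem_iUnion₂.1 (hCt hz)
    refine mem_iUnion₂.2 ⟨y, hy, ?_⟩
    rw [Metric.mem_ball] at hzy ⊢
    linarith [dist_triangle x z y]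
  · rw [compl_iInter]
    exact (measure_iUnion_le _).trans ((ENNReal.tsum_le_tsum fun m => hμ m μ hμS).trans hsum.le)

/-- Chebyshev's inequality for vector-valued functions. -/
theorem measure_lt_norm_le_ofReal_integral_sq_div {Ω F : Type*} [MeasurableSpace Ω]
    [NormedAddCommGroup F] {P : Measure Ω} [IsFiniteMeasure P] {f : Ω → F} (hf : MemLp f 2 P)
    {r : ℝ} (hr : 0 < r) :
    P {ω | r < ‖f ω‖} ≤ ENNReal.ofReal ((∫ ω, ‖f ω‖ ^ 2 ∂P) / r ^ 2) := by
  have hint : Integrable (fun ω => ‖f ω‖ ^ 2) P := hf.integrable_norm_pow two_ne_zero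
  have h := mul_meas_ge_le_integral_of_nonneg
    (ae_of_all P fun ω => sq_nonneg ‖f ω‖) hint (r ^ 2)
  have hsub : {ω | r < ‖f ω‖} ⊆ {ω | r ^ 2 ≤ ‖f ω‖ ^ 2} := fun ω hω =>
    pow_le_pow_left₀ hr.le (le_of_lt hω) 2
  refine (measure_mono hsub).trans ?_
  rw [← ofReal_measureReal]
  refine ENNReal.ofReal_le_ofReal ?_
  rw [le_div_iff₀ (by positivity), mul_comm]
  exact h

section Hilbert

variable {Ω E : Type*} [MeasurableSpace Ω] [NormedAddCommGroup E] [InnerProductSpace ℝ E]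
  {P : Measure Ω}

/-- Square-integrable random vectors are close in `L²` to their projection on a finite-dimensional
subspace, namely the span of the range of an approximating simple function. -/
theorem exists_finiteDimensional_integral_sq_norm_sub_starProjection_le {f : Ω → E}
    (hf : MemLp f 2 P) {δ : ℝ} (hδ : 0 < δ) :
    ∃ (V : Submodule ℝ E) (_ : FiniteDimensional ℝ V),
      ∫ ω, ‖f ω - V.starProjection (f ω)‖ ^ 2 ∂P ≤ δ := by
  obtain ⟨g, hg, hgL⟩ := hf.exists_simpleFunc_eLpNorm_sub_lt (by simp)
    (ε := ENNReal.ofReal (Real.sqrt δ)) (by simpa using hδ)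
  have hfin : FiniteDimensional ℝ (Submodule.span ℝ (range g)) :=
    FiniteDimensional.span_of_finite ℝ g.finite_range
  refine ⟨Submodule.span ℝ (range g), hfin, ?_⟩
  have hfg : MemLp (f - ⇑g) 2 P := hf.sub hgL
  have hle : ∫ ω, ‖f ω - (Submodule.span ℝ (range g)).starProjection (f ω)‖ ^ 2 ∂P
      ≤ ∫ ω, ‖(f - ⇑g) ω‖ ^ 2 ∂P := by
    refine integral_mono_of_nonneg (ae_of_all _ fun ω => sq_nonneg _)
      (hfg.integrable_norm_pow two_ne_zero) (ae_of_all _ fun ω => ?_)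
    refine pow_le_pow_left₀ (norm_nonneg _) ?_ 2
    rw [Submodule.starProjection_minimal]
    exact ciInf_le ⟨0, by rintro _ ⟨x, rfl⟩; positivity⟩
      (⟨g ω, Submodule.subset_span (mem_range_self ω)⟩ : Submodule.span ℝ (range g))
  refine hle.trans ?_
  rw [hfg.eLpNorm_eq_integral_rpow_norm (by simp) (by simp),
    ENNReal.ofReal_lt_ofReal_iff (Real.sqrt_pos.2 hδ)] at hg
  simp only [ENNReal.toReal_ofNat, Real.rpow_ofNat] at hg
  rw [← one_div, ← Real.sqrt_eq_rpow] at hg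
  exact ((Real.sqrt_lt_sqrt_iff (integral_nonneg fun ω => sq_nonneg _)).1 hg).le

variable [MeasurableSpace E] [BorelSpace E] [CompleteSpace E] {X : ℕ → Ω → E}

/-- The cross terms `E⟪X i, X j⟫` vanish by independence and centring. -/
theorem integral_norm_sq_sum_eq_mul [IsProbabilityMeasure P] (hX : MemLp (X 0) 2 P)
    (h0 : ∫ ω, X 0 ω ∂P = 0)
    (hindep : iIndepFun X P) (hident : ∀ i, IdentDistrib (X i) (X 0) P P) (n : ℕ) :
    ∫ ω, ‖∑ k ∈ Finset.range n, X k ω‖ ^ 2 ∂P = n * ∫ ω, ‖X 0 ω‖ ^ 2 ∂P := by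
  have hL : ∀ i, MemLp (X i) 2 P := fun i => (hident i).memLp_iff.2 hX
  have hI : ∀ i, Integrable (X i) P := fun i => (hL i).integrable (by norm_num)
  have hcross : ∀ i j, i ≠ j →
      Integrable (fun ω => ⟪X i ω, X j ω⟫) P ∧ ∫ ω, ⟪X i ω, X j ω⟫ ∂P = 0 := by
    intro i j hij
    refine ⟨(hindep.indepFun hij).integrable_bilin (hI i) (hI j) (innerSL ℝ), ?_⟩
    refine ((hindep.indepFun hij).integral_bilin (hI i) (hI j) (innerSL ℝ)).trans ?_
    rw [(hident i).integral_eq, h0, map_zero, zero_apply]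
  induction n with
  | zero => simp
  | succ n ih =>
    have hS : MemLp (fun ω => ∑ k ∈ Finset.range n, X k ω) 2 P :=
      memLp_finsetSum _ fun i _ => hL i
    have hne : ∀ k ∈ Finset.range n, k ≠ n := fun k hk => (Finset.mem_range.1 hk).ne
    have hexp : ∀ ω, ‖∑ k ∈ Finset.range (n + 1), X k ω‖ ^ 2
        = ‖∑ k ∈ Finset.range n, X k ω‖ ^ 2 + 2 * ∑ k ∈ Finset.range n, ⟪X k ω, X n ω⟫
          + ‖X n ω‖ ^ 2 := fun ω => by
      rw [Finset.sum_range_succ, norm_add_sq_real, sum_inner]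
    simp_rw [hexp]
    have hi1 : Integrable (fun ω => ‖∑ k ∈ Finset.range n, X k ω‖ ^ 2) P :=
      hS.integrable_norm_pow two_ne_zero
    have hi2 : Integrable (fun ω => 2 * ∑ k ∈ Finset.range n, ⟪X k ω, X n ω⟫) P :=
      (integrable_finsetSum _ fun k hk => (hcross k n (hne k hk)).1).const_mul 2
    have hi3 : Integrable (fun ω => ‖X n ω‖ ^ 2) P := (hL n).integrable_norm_pow two_ne_zero
    rw [integral_add (by exact hi1.add hi2) hi3, integral_add hi1 hi2, ih, integral_const_mul,
      integral_finsetSum _ fun k hk => (hcross k n (hne k hk)).1,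
      Finset.sum_eq_zero fun k hk => (hcross k n (hne k hk)).2]
    have hsq : ∫ ω, ‖X n ω‖ ^ 2 ∂P = ∫ ω, ‖X 0 ω‖ ^ 2 ∂P := (hident n).norm.sq.integral_eq
    rw [hsq]
    push_cast
    ring

/-- This is an equality except for `n = 0`, where `(√0)⁻¹ = 0` and the left-hand side is `0`. -/
theorem integral_norm_sq_inv_sqrt_smul_sum_le [IsProbabilityMeasure P] (hX : MemLp (X 0) 2 P)
    (h0 : ∫ ω, X 0 ω ∂P = 0)
    (hindep : iIndepFun X P) (hident : ∀ i, IdentDistrib (X i) (X 0) P P) (n : ℕ) :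
    ∫ ω, ‖(√(n : ℝ))⁻¹ • ∑ k ∈ Finset.range n, X k ω‖ ^ 2 ∂P ≤ ∫ ω, ‖X 0 ω‖ ^ 2 ∂P := by
  simp_rw [norm_smul, mul_pow]
  rw [integral_const_mul, integral_norm_sq_sum_eq_mul hX h0 hindep hident, norm_inv, inv_pow,
    Real.norm_eq_abs, sq_abs, Real.sq_sqrt n.cast_nonneg, ← mul_assoc]
  exact mul_le_of_le_one_left (integral_nonneg fun ω => sq_nonneg _) (inv_mul_le_one (a := (n : ℝ)))

theorem isTightMeasureSet_map_inv_sqrt_smul_sum [SecondCountableTopology E] [IsProbabilityMeasure P] (hX : MemLp (X 0) 2 P)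
    (h0 : ∫ ω, X 0 ω ∂P = 0)
    (hindep : iIndepFun X P) (hident : ∀ i, IdentDistrib (X i) (X 0) P P) :
    IsTightMeasureSet
      (range fun n : ℕ => P.map fun ω => (√(n : ℝ))⁻¹ • ∑ k ∈ Finset.range n, X k ω) := by
  refine isTightMeasureSet_of_forall_exists_measure_compl_cthickening_le fun ε hε η hη => ?_
  obtain rfl | hεtop := eq_or_ne ε ∞
  · exact ⟨∅, isCompact_empty, fun _ _ => le_top⟩
  have hL : ∀ i, MemLp (X i) 2 P := fun i => (hident i).memLp_iff.2 hX
  have hS : ∀ n : ℕ, MemLp (fun ω => (√(n : ℝ))⁻¹ • ∑ k ∈ Finset.range n, X k ω) 2 P :=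
    fun n => (memLp_finsetSum _ fun i _ => hL i).const_smul _
  have he : 0 < ε.toReal := ENNReal.toReal_pos hε.ne' hεtop
  set M := ∫ ω, ‖X 0 ω‖ ^ 2 ∂P with hM
  have hM0 : 0 ≤ M := integral_nonneg fun ω => sq_nonneg _
  obtain ⟨V, hV, hVle⟩ := exists_finiteDimensional_integral_sq_norm_sub_starProjection_le hX
    (δ := ε.toReal / 2 * η ^ 2) (by positivity)
  -- `R` and the bound for `V` are chosen so that each Chebyshev estimate contributes `ε / 2`;
  -- `M + 1` instead of `M` keeps `R` positive when `X 0` vanishes.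
  set R := √(2 * (M + 1) / ε.toReal) with hR
  have hRpos : 0 < R := Real.sqrt_pos.2 (by positivity)
  have hRsq : R ^ 2 = 2 * (M + 1) / ε.toReal := Real.sq_sqrt (by positivity)
  set L : E →L[ℝ] E := ContinuousLinearMap.id ℝ E - V.starProjection with hLdef
  have hcpt : IsCompact ((V : Set E) ∩ Metric.closedBall 0 R) := by
    have := (isCompact_closedBall (0 : V) R).image continuous_subtype_val
    convert this using 1
    ext x
    simp [and_comm]
  refine ⟨_, hcpt, ?_⟩
  rintro _ ⟨n, rfl⟩
  dsimp only
  rw [Measure.map_apply_of_aemeasurable (hS n).aestronglyMeasurable.aemeasurable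
    Metric.isClosed_cthickening.measurableSet.compl]
  set Sn : Ω → E := fun ω => (√(n : ℝ))⁻¹ • ∑ k ∈ Finset.range n, X k ω with hSn
  have hsub : Sn ⁻¹' (Metric.cthickening η ((V : Set E) ∩ Metric.closedBall 0 R))ᶜ ⊆
      {ω | R < ‖Sn ω‖} ∪ {ω | η < ‖L (Sn ω)‖} := by
    intro ω hω
    by_contra hcon
    simp only [mem_union, mem_ofPred_eq, not_or, not_lt] at hcon
    refine hω (Metric.mem_cthickening_of_dist_le _ (V.starProjection (Sn ω)) _ _
      ⟨V.starProjection_apply_mem _, ?_⟩ ?_)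
    · rw [mem_closedBall_zero_iff]
      exact (V.norm_starProjection_apply_le _).trans hcon.1
    · rw [dist_eq_norm]
      exact hcon.2
  have h1 : P {ω | R < ‖Sn ω‖} ≤ ENNReal.ofReal (ε.toReal / 2) := by
    refine (measure_lt_norm_le_ofReal_integral_sq_div (hS n) hRpos).trans
      (ENNReal.ofReal_le_ofReal ?_)
    rw [div_le_iff₀ (by positivity), hRsq]
    have := integral_norm_sq_inv_sqrt_smul_sum_le hX h0 hindep hident n
    have h2 : ε.toReal / 2 * (2 * (M + 1) / ε.toReal) = M + 1 := by field_simp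
    rw [h2]
    linarith
  have h2 : P {ω | η < ‖L (Sn ω)‖} ≤ ENNReal.ofReal (ε.toReal / 2) := by
    refine (measure_lt_norm_le_ofReal_integral_sq_div (L.comp_memLp' (hS n)) hη).trans
      (ENNReal.ofReal_le_ofReal ?_)
    rw [div_le_iff₀ (by positivity)]
    have hVle' : ∫ ω, ‖L (X 0 ω)‖ ^ 2 ∂P ≤ ε.toReal / 2 * η ^ 2 := hVle
    refine le_trans ?_ hVle'
    -- The second moment bound applies to the i.i.d. centred vectors `L (X k)`.
    have h := integral_norm_sq_inv_sqrt_smul_sum_le (X := fun k ω => L (X k ω))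
      (L.comp_memLp' hX)
      (by rw [L.integral_comp_comm (hX.integrable (by norm_num)), h0, map_zero])
      (hindep.comp (fun _ => L) fun _ => L.continuous.measurable)
      (fun i => (hident i).comp L.continuous.measurable) n
    simpa only [hSn, Function.comp_apply, map_smul, map_sum] using h
  calc _ ≤ P ({ω | R < ‖Sn ω‖} ∪ {ω | η < ‖L (Sn ω)‖}) := measure_mono hsub
    _ ≤ ENNReal.ofReal (ε.toReal / 2) + ENNReal.ofReal (ε.toReal / 2) :=
      (measure_union_le _ _).trans (add_le_add h1 h2)
    _ = ε := by
      rw [← ENNReal.ofReal_add (by positivity) (by positivity), add_halves,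
        ENNReal.ofReal_toReal hεtop]

end Hilbert

/-! ### Central limit theorem in a separable Hilbert space -/

section CentralLimit

variable {Ω E : Type*} [MeasurableSpace Ω] [NormedAddCommGroup E] [InnerProductSpace ℝ E]
  [MeasurableSpace E] [BorelSpace E] [SecondCountableTopology E] [CompleteSpace E]

/-- Lévy's continuity theorem in infinite dimension, where tightness of the sequence is not implied
by the convergence of characteristic functions and has to be assumed. -/
theorem tendsto_of_isTightMeasureSet_of_tendsto_charFun {μ : ℕ → ProbabilityMeasure E}
    {ν : ProbabilityMeasure E}
    (htight : IsTightMeasureSet {(μ n : Measure E) | n})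
    (h : ∀ t : E, Tendsto (fun n => charFun (μ n : Measure E) t) atTop
      (𝓝 (charFun (ν : Measure E) t))) :
    Tendsto μ atTop (𝓝 ν) := by
  refine ProbabilityMeasure.tendsto_of_tight_of_separatesPoints htight (𝕜 := ℂ)
    (A := BoundedContinuousFunction.charPoly Real.continuous_probChar
      (L := innerₗ E) continuous_inner) ?_ ?_
  · refine BoundedContinuousFunction.separatesPoints_charPoly
      Real.continuous_probChar
      Real.probChar_ne_one _ ?_
    exact fun v hv => DFunLike.ne_iff.mpr ⟨v, inner_self_ne_zero.mpr hv⟩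
  · exact fun g => ProbabilityMeasure.tendsto_charPoly_of_tendsto_charFun h

/-- A tight sequence whose characteristic functions converge has a limit law: `φ` need not be known
in advance to be a characteristic function. -/
theorem exists_tendsto_of_isTightMeasureSet_of_tendsto_charFun {μ : ℕ → ProbabilityMeasure E}
    {φ : E → ℂ}
    (htight : IsTightMeasureSet {(μ n : Measure E) | n})
    (h : ∀ t : E, Tendsto (fun n => charFun (μ n : Measure E) t) atTop (𝓝 (φ t))) :
    ∃ ν : ProbabilityMeasure E, (∀ t, charFun (ν : Measure E) t = φ t) ∧
      Tendsto μ atTop (𝓝 ν) := by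
  have hcpt : IsCompact (closure {μ n | n}) :=
    isCompact_closure_of_isTightMeasureSet (by simpa using htight)
  -- Prokhorov's theorem gives a limit along an ultrafilter finer than `atTop`, which is enough to
  -- identify its characteristic function.
  obtain ⟨ν, -, hν : Tendsto μ (Ultrafilter.of (atTop : Filter ℕ) : Filter ℕ) (𝓝 ν)⟩ :=
    hcpt.ultrafilter_le_nhds ((Ultrafilter.of atTop).map μ)
      (le_principal_iff.2 (Filter.mem_map.2
        (univ_mem' fun n => subset_closure (mem_range_self n))))
  have hφ : ∀ t, charFun (ν : Measure E) t = φ t := fun t => by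
    rw [ProbabilityMeasure.tendsto_iff_forall_integral_rclike_tendsto ℂ] at hν
    have h1 := hν (BoundedContinuousFunction.innerProbChar t)
    simp_rw [← charFun_eq_integral_innerProbChar] at h1
    exact tendsto_nhds_unique h1 ((h t).mono_left (Ultrafilter.of_le atTop))
  exact ⟨ν, hφ, tendsto_of_isTightMeasureSet_of_tendsto_charFun htight
    fun t => by rw [hφ]; exact h t⟩

variable {P : Measure Ω} [IsProbabilityMeasure P] {X : ℕ → Ω → E}

/-- The one-dimensional central limit theorem in the direction `t`. -/
theorem tendsto_charFun_map_inv_sqrt_smul_sum (hX : MemLp (X 0) 2 P)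
    (h0 : ∫ ω, X 0 ω ∂P = 0)
    (hindep : iIndepFun X P) (hident : ∀ i, IdentDistrib (X i) (X 0) P P) (t : E) :
    Tendsto (fun n : ℕ =>
        charFun (P.map fun ω => (√(n : ℝ))⁻¹ • ∑ k ∈ Finset.range n, X k ω) t) atTop
      (𝓝 (Complex.exp (-(covarianceBilin (P.map (X 0)) t t : ℂ) / 2))) := by
  have hL : ∀ i, MemLp (X i) 2 P := fun i => (hident i).memLp_iff.2 hX
  have hcont : Measurable fun x : E => ⟪t, x⟫ := by fun_prop
  have hmean : ∫ ω, ⟪t, X 0 ω⟫ ∂P = 0 := by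
    rw [integral_inner (hX.integrable (by norm_num)), h0, inner_zero_right]
  have hm0 : AEMeasurable (X 0) P := hX.aestronglyMeasurable.aemeasurable
  have hvar : covarianceBilin (P.map (X 0)) t t = Var[fun ω => ⟪t, X 0 ω⟫; P] := by
    have := Measure.isProbabilityMeasure_map hm0
    rw [covarianceBilin_self, variance_map (by fun_prop) hm0]
    · rfl
    · exact (memLp_map_measure_iff (by fun_prop) hm0).2 hX
  have hclt := tendstoInDistribution_inv_sqrt_mul_sum_sub (X := fun k ω => ⟪t, X k ω⟫)
    (Y := id) (P' := gaussianReal 0 Var[fun ω => ⟪t, X 0 ω⟫; P].toNNReal) (P := P)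
    ⟨aemeasurable_id, Measure.map_id⟩ (hX.const_inner t)
    (hindep.comp (fun _ x => ⟪t, x⟫) fun _ => hcont) (fun i => (hident i).comp hcont)
  have h1 := ProbabilityMeasure.tendsto_iff_tendsto_charFun.1 hclt.tendsto 1
  simp only [ProbabilityMeasure.coe_mk, Measure.map_id, charFun_gaussianReal, hmean] at h1
  have hS : ∀ n : ℕ, AEMeasurable (fun ω => (√(n : ℝ))⁻¹ • ∑ k ∈ Finset.range n, X k ω) P :=
    fun n => ((memLp_finsetSum _ fun i _ => hL i).const_smul
      (√(n : ℝ))⁻¹).aestronglyMeasurable.aemeasurable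
  convert h1 using 2 with n
  · rw [charFun_eq_charFunDual_toDualMap, charFunDual_eq_charFun_map_one,
      AEMeasurable.map_map_of_aemeasurable (by fun_prop) (hS n)]
    congr 2
    ext ω
    simp
  · rw [hvar, Real.coe_toNNReal _ (variance_nonneg _ _)]
    simp [neg_div]

/-- **Central limit theorem in a separable Hilbert space**: normalised sums of i.i.d. centred
square-integrable random vectors converge in distribution to a centred Gaussian law with the same
covariance. -/
theorem exists_isGaussian_tendstoInDistribution_inv_sqrt_smul_sum (hX : MemLp (X 0) 2 P)
    (h0 : ∫ ω, X 0 ω ∂P = 0)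
    (hindep : iIndepFun X P) (hident : ∀ i, IdentDistrib (X i) (X 0) P P) :
    ∃ ν : ProbabilityMeasure E, IsGaussian (ν : Measure E) ∧ ∫ x, x ∂(ν : Measure E) = 0 ∧
      covarianceBilin (ν : Measure E) = covarianceBilin (P.map (X 0)) ∧
      TendstoInDistribution (fun (n : ℕ) ω => (√(n : ℝ))⁻¹ • ∑ k ∈ Finset.range n, X k ω) atTop
        (id : E → E) (fun _ => P) (ν : Measure E) := by
  have hL : ∀ i, MemLp (X i) 2 P := fun i => (hident i).memLp_iff.2 hX
  have hS : ∀ n : ℕ, AEMeasurable (fun ω => (√(n : ℝ))⁻¹ • ∑ k ∈ Finset.range n, X k ω) P :=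
    fun n => ((memLp_finsetSum _ fun i _ => hL i).const_smul
      (√(n : ℝ))⁻¹).aestronglyMeasurable.aemeasurable
  obtain ⟨ν, hν, hlim⟩ := exists_tendsto_of_isTightMeasureSet_of_tendsto_charFun
    (μ := fun n => ⟨_, Measure.isProbabilityMeasure_map (hS n)⟩)
    (isTightMeasureSet_map_inv_sqrt_smul_sum hX h0 hindep hident)
    (tendsto_charFun_map_inv_sqrt_smul_sum hX h0 hindep hident)
  have hform : ∀ t, charFun (ν : Measure E) t =
      Complex.exp (⟪t, (0 : E)⟫ * Complex.I - covarianceBilin (P.map (X 0)) t t / 2) :=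
    fun t => by rw [hν, inner_zero_right]; congr 1; simp [neg_div]
  obtain ⟨hmean, hcov⟩ := gaussian_charFun_congr 0 (covarianceBilin (P.map (X 0)))
    isPosSemidef_covarianceBilin hform
  refine ⟨ν, isGaussian_iff_gaussian_charFun.2 ⟨0, _, isPosSemidef_covarianceBilin, hform⟩,
    hmean.symm, hcov.symm, ⟨hS, aemeasurable_id, ?_⟩⟩
  have hid : (⟨(ν : Measure E).map id, Measure.isProbabilityMeasure_map aemeasurable_id⟩ :
      ProbabilityMeasure E) = ν := Subtype.ext Measure.map_id
  rw [hid]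
  exact hlim

end CentralLimit

/-! ### The summands of the empirical process -/

noncomputable section

instance isProbabilityMeasure_unitMeasure : IsProbabilityMeasure unitMeasure := ⟨by simp⟩

/-- The contribution `t ↦ (2 u - 1) 1{u ≥ t} - t (1 - t)` of an observation `u` to the process;
for uniform `u` its mean at each `t` is `0`. -/
def centredSummand (u t : ℝ) : ℝ := (2 * u - 1) * (if t ≤ u then 1 else 0) - t * (1 - t)

theorem measurable_uncurry_centredSummand : Measurable (Function.uncurry centredSummand) := by
  unfold centredSummand
  refine Measurable.sub (Measurable.mul (by fun_prop) (Measurable.ite ?_ measurable_const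
    measurable_const)) (by fun_prop)
  exact measurableSet_le measurable_snd measurable_fst

theorem abs_centredSummand_le {u t : ℝ} (hu : u ∈ Ioo (0 : ℝ) 1) (ht : t ∈ Ioo (0 : ℝ) 1) :
    |centredSummand u t| ≤ 2 := by
  unfold centredSummand
  obtain ⟨hu0, hu1⟩ := hu
  obtain ⟨ht0, ht1⟩ := ht
  rw [abs_le]
  split_ifs <;> constructor <;> nlinarith

theorem memLp_mul_one_sub : MemLp (fun t : ℝ => t * (1 - t)) 2 unitMeasure := by
  refine MemLp.of_bound (by fun_prop) 1 ?_
  filter_upwards [ae_restrict_mem measurableSet_Ioo] with t ht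
  rw [Real.norm_eq_abs, abs_le]
  constructor <;> nlinarith [ht.1, ht.2]

/-- The element of `L²(0,1)` represented by `centredSummand u`, built from `indicatorConstLp` so
that continuity in `u` follows from continuity of indicators in the underlying set. -/
def centredSummandLp (u : ℝ) : L2Unit :=
  (2 * u - 1) • indicatorConstLp 2 (measurableSet_Iic (a := u)) (measure_ne_top _ _) (1 : ℝ)
    - memLp_mul_one_sub.toLp _

theorem coeFn_centredSummandLp (u : ℝ) :
    centredSummandLp u =ᵐ[unitMeasure] centredSummand u := by
  unfold centredSummandLp
  filter_upwards [Lp.coeFn_sub ((2 * u - 1) • indicatorConstLp 2 (measurableSet_Iic (a := u))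
      (measure_ne_top unitMeasure _) (1 : ℝ)) (memLp_mul_one_sub.toLp _),
    Lp.coeFn_smul (2 * u - 1) (indicatorConstLp 2 (measurableSet_Iic (a := u))
      (measure_ne_top unitMeasure _) (1 : ℝ)),
    indicatorConstLp_coeFn (p := 2) (hs := measurableSet_Iic (a := u))
      (hμs := measure_ne_top unitMeasure _) (c := (1 : ℝ)),
    memLp_mul_one_sub.coeFn_toLp] with t h1 h2 h3 h4
  rw [h1, Pi.sub_apply, h2, Pi.smul_apply, h3, h4]
  simp [centredSummand, indicator_apply]

theorem continuous_centredSummandLp : Continuous centredSummandLp := by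
  have h2 : Continuous fun u : ℝ => 2 * u - 1 := by fun_prop
  refine Continuous.sub (h2.smul
    (continuous_indicatorConstLp_set ENNReal.ofNat_ne_top fun u => ?_)) continuous_const
  refine tendsto_of_tendsto_of_tendsto_of_le_of_le (g := fun _ => 0)
    (h := fun v => ENNReal.ofReal |v - u|) tendsto_const_nhds ?_ (fun _ => zero_le) fun v => ?_
  · have : Tendsto (fun v : ℝ => |v - u|) (𝓝 u) (𝓝 0) := by
      have h : Continuous fun v : ℝ => |v - u| := by fun_prop
      simpa using h.tendsto u
    simpa using ENNReal.tendsto_ofReal this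
  -- `Iic v` and `Iic u` differ by an interval of length `|v - u|`.
  · refine (Measure.restrict_apply_le _ _).trans ?_
    dsimp only
    rw [← Real.volume_uIoc]
    refine measure_mono fun x hx => ?_
    rw [mem_symmDiff, mem_Iic, mem_Iic] at hx
    rw [mem_uIoc]
    grind

theorem exists_norm_centredSummandLp_le :
    ∃ C : ℝ, ∀ u ∈ Ioo (0 : ℝ) 1, ‖centredSummandLp u‖ ≤ C := by
  obtain ⟨C, hC⟩ := (isCompact_Icc (a := (0 : ℝ)) (b := 1)).exists_bound_of_continuousOn
    continuous_centredSummandLp.continuousOn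
  exact ⟨C, fun u hu => hC u (Ioo_subset_Icc_self hu)⟩

theorem memLp_centredSummandLp : MemLp centredSummandLp 2 unitMeasure := by
  obtain ⟨C, hC⟩ := exists_norm_centredSummandLp_le
  refine MemLp.of_bound continuous_centredSummandLp.aestronglyMeasurable C ?_
  filter_upwards [ae_restrict_mem measurableSet_Ioo] with u hu using hC u hu

/-- The centring `√n t (1 - t)` is distributed over the `n` summands, as `√n = n^{-1/2} n`. -/
theorem zHat_eq_inv_sqrt_smul_sum (u : ℕ → ℝ) (n : ℕ) :
    zHat u n = (√(n : ℝ))⁻¹ • ∑ j ∈ Finset.range n, centredSummandLp (u j) := by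
  have hall : ∀ᵐ t ∂unitMeasure, ∀ j, centredSummandLp (u j) t = centredSummand (u j) t :=
    ae_all_iff.2 fun j => coeFn_centredSummandLp (u j)
  refine Lp.ext ?_
  filter_upwards [(memLp_zHatFun u n).coeFn_toLp,
    Lp.coeFn_smul (√(n : ℝ))⁻¹ (∑ j ∈ Finset.range n, centredSummandLp (u j)),
    Lp.coeFn_finsetSum (Finset.range n) fun j => centredSummandLp (u j), hall] with t h1 h2 h3 h4
  rw [zHat, h1, h2, Pi.smul_apply, h3, Finset.sum_apply, Finset.sum_congr rfl fun j _ => h4 j]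
  simp only [zHatFun, centredSummand, Finset.sum_sub_distrib, Finset.sum_const, Finset.card_range,
    nsmul_eq_mul, smul_eq_mul]
  rw [mul_sub (√(n : ℝ))⁻¹, ← mul_assoc (√(n : ℝ))⁻¹ (n : ℝ), inv_mul_eq_div (√(n : ℝ)) (n : ℝ),
    Real.div_sqrt]

theorem tStat_eq_norm_sq_zHat (u : ℕ → ℝ) (n : ℕ) : tStat u n = ‖zHat u n‖ ^ 2 := by
  rw [← real_inner_self_eq_norm_sq, L2.inner_def, tStat, ← integral_const_mul]
  refine integral_congr_ae ?_
  filter_upwards [(memLp_zHatFun u n).coeFn_toLp] with t ht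
  rw [zHat, ht, real_inner_self_eq_norm_sq, Real.norm_eq_abs, sq_abs, sq_abs, zHatFun]
  obtain rfl | hn := n.eq_zero_or_pos
  · simp
  have hn' : (0 : ℝ) < n := by exact_mod_cast hn
  have hs : √(n : ℝ) * √(n : ℝ) = n := Real.mul_self_sqrt hn'.le
  generalize (∑ j ∈ Finset.range n, (2 * u j - 1) * (if t ≤ u j then 1 else 0) : ℝ) = A
  have : (√(n : ℝ))⁻¹ * A - √(n : ℝ) * (t * (1 - t)) =
      √(n : ℝ) * (1 / (n : ℝ) * A - t * (1 - t)) := by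
    have hdiv : √(n : ℝ) * (1 / (n : ℝ)) = (√(n : ℝ))⁻¹ := by
      rw [mul_one_div, Real.sqrt_div_self', one_div]
    rw [mul_sub (√(n : ℝ)), ← mul_assoc (√(n : ℝ)) (1 / (n : ℝ)), hdiv]
  rw [this, mul_pow, sq (√(n : ℝ)), hs]

/-! ### Mean and covariance of the summands -/

/-- Fubini's theorem on the unit square for an integrable times a bounded function. -/
theorem integral_integral_mul_swap {f : ℝ → ℝ} (hf : Integrable f unitMeasure) {ψ : ℝ → ℝ → ℝ}
    (hψ : Measurable (Function.uncurry ψ)) {C : ℝ}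
    (hC : ∀ u ∈ Ioo (0 : ℝ) 1, ∀ t ∈ Ioo (0 : ℝ) 1, |ψ u t| ≤ C) :
    ∫ u, ∫ t, f t * ψ u t ∂unitMeasure ∂unitMeasure =
      ∫ t, f t * ∫ u, ψ u t ∂unitMeasure ∂unitMeasure := by
  rw [integral_integral_swap]
  · simp_rw [integral_const_mul]
  · refine (hf.comp_snd unitMeasure).mul_bdd (c := C) hψ.aestronglyMeasurable ?_
    rw [Measure.prod_restrict]
    filter_upwards [ae_restrict_mem (measurableSet_Ioo.prod measurableSet_Ioo)] with z hz
    exact hC z.1 hz.1 z.2 hz.2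

theorem inner_centredSummandLp (f : L2Unit) (u : ℝ) :
    ⟪f, centredSummandLp u⟫ = ∫ t, f t * centredSummand u t ∂unitMeasure := by
  rw [L2.inner_def]
  refine integral_congr_ae ?_
  filter_upwards [coeFn_centredSummandLp u] with t ht
  rw [ht, RCLike.inner_apply, conj_trivial, mul_comm]

theorem integrable_ite_le {p : ℝ → ℝ} (hp : Continuous p) (m : ℝ) :
    Integrable (fun u => if m ≤ u then p u else 0) unitMeasure := by
  have h : Integrable p unitMeasure :=
    (hp.integrableOn_Icc (a := 0) (b := 1)).mono_set Ioo_subset_Icc_self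
  exact h.indicator (measurableSet_Ici (a := m))

/-- `∫₀¹ p(u) 1{m ≤ u} du = F(1) - F(m)` for a primitive `F` of `p`. -/
theorem integral_ite_le {p F : ℝ → ℝ} (hp : Continuous p) (hF : ∀ u, HasDerivAt F (p u) u)
    {m : ℝ} (hm : m ∈ Ioo (0 : ℝ) 1) :
    ∫ u, (if m ≤ u then p u else 0) ∂unitMeasure = F 1 - F m := by
  have hset : Ioo (0 : ℝ) 1 ∩ Ici m = Ico m 1 := by
    ext x
    simp only [mem_inter_iff, mem_Ioo, mem_Ici, mem_Ico]
    have := hm.1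
    grind
  calc ∫ u, (if m ≤ u then p u else 0) ∂unitMeasure
      = ∫ u in Ioo (0 : ℝ) 1, (Ici m).indicator p u := rfl
    _ = ∫ u in m..1, p u := by
      rw [setIntegral_indicator measurableSet_Ici, hset, integral_Ico_eq_integral_Ioc,
        intervalIntegral.integral_of_le hm.2.le]
    _ = F 1 - F m := intervalIntegral.integral_eq_sub_of_hasDerivAt (fun u _ => hF u)
      (hp.intervalIntegrable _ _)

theorem integral_ite_le_two_mul_sub_one {m : ℝ} (hm : m ∈ Ioo (0 : ℝ) 1) :
    ∫ u, (if m ≤ u then 2 * u - 1 else 0) ∂unitMeasure = m * (1 - m) := by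
  rw [integral_ite_le (F := fun u => u ^ 2 - u) (by fun_prop) (fun u => ?_) hm]
  · ring
  · refine ((hasDerivAt_pow 2 u).sub (hasDerivAt_id u)).congr_deriv ?_
    simp

theorem integral_ite_le_two_mul_sub_one_sq {m : ℝ} (hm : m ∈ Ioo (0 : ℝ) 1) :
    ∫ u, (if m ≤ u then (2 * u - 1) ^ 2 else 0) ∂unitMeasure = (1 - (2 * m - 1) ^ 3) / 6 := by
  rw [integral_ite_le (F := fun u => (2 * u - 1) ^ 3 / 6) (by fun_prop) (fun u => ?_) hm]
  · ring
  · refine (((((hasDerivAt_id u).const_mul 2).sub_const 1).pow 3).div_const 6).congr_deriv ?_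
    simp only [id_eq]
    push_cast
    ring

theorem integral_centredSummand {t : ℝ} (ht : t ∈ Ioo (0 : ℝ) 1) :
    ∫ u, centredSummand u t ∂unitMeasure = 0 := by
  simp only [centredSummand, mul_ite, mul_one, mul_zero]
  rw [integral_sub (integrable_ite_le (by fun_prop) t) (integrable_const _),
    integral_ite_le_two_mul_sub_one ht]
  simp

theorem integral_centredSummand_mul {s t : ℝ} (hs : s ∈ Ioo (0 : ℝ) 1) (ht : t ∈ Ioo (0 : ℝ) 1) :
    ∫ u, centredSummand u s * centredSummand u t ∂unitMeasure = kernelZ s t := by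
  have hexp : ∀ u, centredSummand u s * centredSummand u t =
      (if max s t ≤ u then (2 * u - 1) ^ 2 else 0)
        - t * (1 - t) * (if s ≤ u then 2 * u - 1 else 0)
        - s * (1 - s) * (if t ≤ u then 2 * u - 1 else 0)
        + s * (1 - s) * (t * (1 - t)) := fun u => by
    simp only [centredSummand, max_le_iff]
    by_cases h1 : s ≤ u <;> by_cases h2 : t ≤ u <;> simp [h1, h2] <;> ring
  have hmax : max s t ∈ Ioo (0 : ℝ) 1 := ⟨lt_max_of_lt_left hs.1, max_lt hs.2 ht.2⟩
  have h1 : Integrable (fun u => if max s t ≤ u then (2 * u - 1) ^ 2 else 0) unitMeasure :=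
    integrable_ite_le (by fun_prop) _
  have h2 : ∀ m c : ℝ, Integrable (fun u => c * if m ≤ u then 2 * u - 1 else 0) unitMeasure :=
    fun m c => (integrable_ite_le (by fun_prop) m).const_mul c
  simp_rw [hexp]
  rw [integral_add (by exact (h1.sub (h2 _ _)).sub (h2 _ _)) (integrable_const _),
    integral_sub (by exact h1.sub (h2 _ _)) (h2 _ _), integral_sub h1 (h2 _ _),
    integral_const_mul, integral_const_mul, integral_ite_le_two_mul_sub_one hs,
    integral_ite_le_two_mul_sub_one ht, integral_ite_le_two_mul_sub_one_sq hmax, kernelZ]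
  simp
  ring

theorem integral_centredSummandLp : ∫ u, centredSummandLp u ∂unitMeasure = 0 := by
  have hint : Integrable centredSummandLp unitMeasure :=
    memLp_centredSummandLp.integrable (by norm_num)
  refine ext_inner_left ℝ fun f => ?_
  rw [← integral_inner hint, inner_zero_right]
  simp_rw [inner_centredSummandLp]
  rw [integral_integral_mul_swap ((Lp.memLp f).integrable (by norm_num))
    measurable_uncurry_centredSummand fun u hu t ht => abs_centredSummand_le hu ht]
  refine integral_eq_zero_of_ae ?_
  filter_upwards [ae_restrict_mem measurableSet_Ioo] with t ht
  rw [integral_centredSummand ht, mul_zero, Pi.zero_apply]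

/-- Two applications of Fubini's theorem bring the integral over `u` inside. -/
theorem integral_inner_centredSummandLp_mul (f g : L2Unit) :
    ∫ u, ⟪f, centredSummandLp u⟫ * ⟪g, centredSummandLp u⟫ ∂unitMeasure =
      ∫ s in Ioo (0 : ℝ) 1, ∫ t in Ioo (0 : ℝ) 1, kernelZ s t * f s * g t := by
  have hG : Measurable fun u => ⟪g, centredSummandLp u⟫ :=
    (continuous_const.inner continuous_centredSummandLp).measurable
  obtain ⟨C, hC⟩ := exists_norm_centredSummandLp_le
  have hfst : ∀ u, ⟪f, centredSummandLp u⟫ * ⟪g, centredSummandLp u⟫ =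
      ∫ s, f s * (centredSummand u s * ⟪g, centredSummandLp u⟫) ∂unitMeasure := fun u => by
    rw [inner_centredSummandLp f, ← integral_mul_const]
    simp_rw [mul_assoc]
  simp_rw [hfst]
  rw [integral_integral_mul_swap (C := 2 * (‖g‖ * C))
    (ψ := fun u s => centredSummand u s * ⟪g, centredSummandLp u⟫)
    ((Lp.memLp f).integrable (by norm_num))
    (measurable_uncurry_centredSummand.mul (hG.comp measurable_fst)) fun u hu s hs => by
      rw [abs_mul]
      exact mul_le_mul (abs_centredSummand_le hu hs) ((abs_real_inner_le_norm _ _).trans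
        (mul_le_mul_of_nonneg_left (hC u hu) (norm_nonneg _))) (abs_nonneg _) (by norm_num)]
  refine integral_congr_ae ?_
  filter_upwards [ae_restrict_mem measurableSet_Ioo] with s hs
  have hsnd : ∀ u, centredSummand u s * ⟪g, centredSummandLp u⟫ =
      ∫ t, g t * (centredSummand u s * centredSummand u t) ∂unitMeasure := fun u => by
    rw [inner_centredSummandLp g, ← integral_const_mul]
    congr 1 with t
    ring
  simp_rw [hsnd]
  rw [integral_integral_mul_swap (C := 2 * 2)
    (ψ := fun u t => centredSummand u s * centredSummand u t)
    ((Lp.memLp g).integrable (by norm_num))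
    (((measurable_uncurry_centredSummand.comp (measurable_fst.prodMk measurable_const)).mul
      measurable_uncurry_centredSummand)) fun u hu t ht => by
      rw [abs_mul]
      exact mul_le_mul (abs_centredSummand_le hu hs) (abs_centredSummand_le hu ht)
        (abs_nonneg _) (by norm_num),
    ← integral_const_mul]
  refine integral_congr_ae ?_
  filter_upwards [ae_restrict_mem measurableSet_Ioo] with t ht
  rw [integral_centredSummand_mul hs ht]
  ring

instance secondCountableTopology_L2Unit : SecondCountableTopology L2Unit :=
  haveI : Fact ((2 : ℝ≥0∞) ≠ ∞) := ⟨ENNReal.ofNat_ne_top⟩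
  inferInstance

theorem covarianceBilin_map_centredSummandLp (f g : L2Unit) :
    covarianceBilin (unitMeasure.map centredSummandLp) f g =
      ∫ s in Ioo (0 : ℝ) 1, ∫ t in Ioo (0 : ℝ) 1, kernelZ s t * f s * g t := by
  have hm : AEMeasurable centredSummandLp unitMeasure :=
    continuous_centredSummandLp.measurable.aemeasurable
  have := Measure.isProbabilityMeasure_map hm
  have hmean : ∫ x, id x ∂(unitMeasure.map centredSummandLp) = 0 := by
    rw [integral_map hm (by fun_prop)]
    exact integral_centredSummandLp
  rw [covarianceBilin_apply ((memLp_map_measure_iff (by fun_prop) hm).2 memLp_centredSummandLp),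
    hmean, integral_map hm (by fun_prop)]
  simp_rw [sub_zero]
  exact integral_inner_centredSummandLp_mul f g

end

/-! ### Convergence of the process and of the test statistic -/

theorem isCentredGaussianElement_id {ν : Measure L2Unit} [IsGaussian ν] (h0 : ∫ x, x ∂ν = 0)
    (hcov : covarianceBilin ν = covarianceBilin (unitMeasure.map centredSummandLp)) :
    IsCentredGaussianElement (id : L2Unit → L2Unit) ν kernelZ where
  hasGaussianLaw := IsGaussian.hasGaussianLaw_id
  mean_eq_zero := h0
  covariance_eq f g := by
    rw [← covarianceBilin_map_centredSummandLp, ← hcov,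
      covarianceBilin_apply_eq_cov IsGaussian.memLp_two_id]
    rfl

theorem theorem2p1 {Ω : Type*} [MeasurableSpace Ω] (P : Measure Ω) [IsProbabilityMeasure P]
    (U : ℕ → Ω → ℝ)
    (hU_unif : ∀ j, pdf.IsUniform (U j) (Ioo (0 : ℝ) 1) P volume)
    (hU_indep : iIndepFun U P) :
    (∀ (n : ℕ) (ω : Ω), tStat (fun j => U j ω) n = ‖zHat (fun j => U j ω) n‖ ^ 2) ∧
    ∃ (Ω' : Type) (_ : MeasurableSpace Ω') (P' : Measure Ω') (_ : IsProbabilityMeasure P')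
      (Z : Ω' → L2Unit),
      IsCentredGaussianElement Z P' kernelZ ∧
      TendstoInDistribution (fun (n : ℕ) (ω : Ω) => zHat (fun j => U j ω) n) atTop Z
        (fun _ => P) P' ∧
      TendstoInDistribution (fun (n : ℕ) (ω : Ω) => tStat (fun j => U j ω) n) atTop
        (fun ω' => ‖Z ω'‖ ^ 2) (fun _ => P) P' := by
  have hm : ∀ j, AEMeasurable (U j) P := fun j =>
    pdf.IsUniform.aemeasurable (by simp) (by simp) (hU_unif j)
  have hlaw : ∀ j, P.map (U j) = unitMeasure := fun j => by
    rw [hU_unif j, ProbabilityTheory.cond]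
    simp
  have hS : Measurable centredSummandLp := continuous_centredSummandLp.measurable
  have hmap : P.map (fun ω => centredSummandLp (U 0 ω)) = unitMeasure.map centredSummandLp := by
    rw [← hlaw 0, AEMeasurable.map_map_of_aemeasurable hS.aemeasurable (hm 0)]
    rfl
  have hident : ∀ j, IdentDistrib (fun ω => centredSummandLp (U j ω))
      (fun ω => centredSummandLp (U 0 ω)) P P := fun j =>
    IdentDistrib.comp ⟨hm j, hm 0, by rw [hlaw, hlaw]⟩ hS
  have hL2 : MemLp (fun ω => centredSummandLp (U 0 ω)) 2 P := by
    have h : ∀ μ : Measure ℝ, μ = unitMeasure → MemLp centredSummandLp 2 μ := by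
      rintro _ rfl
      exact memLp_centredSummandLp
    exact (h _ (hlaw 0)).comp_of_map (hm 0)
  have hmean : ∫ ω, centredSummandLp (U 0 ω) ∂P = 0 := by
    rw [← integral_map (hm 0) hS.aestronglyMeasurable, hlaw, integral_centredSummandLp]
  obtain ⟨ν, hν, hν0, hcov, hlim⟩ := exists_isGaussian_tendstoInDistribution_inv_sqrt_smul_sum
    (X := fun j ω => centredSummandLp (U j ω)) hL2 hmean
    (hU_indep.comp (fun _ => centredSummandLp) fun _ => hS) hident
  rw [hmap] at hcov
  simp_rw [← zHat_eq_inv_sqrt_smul_sum (fun j => U j _)] at hlim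
  refine ⟨fun n ω => tStat_eq_norm_sq_zHat _ n, L2Unit, inferInstance, ν, inferInstance, id,
    isCentredGaussianElement_id hν0 hcov, hlim, ?_⟩
  simp_rw [tStat_eq_norm_sq_zHat]
  exact hlim.continuous_comp (g := fun x : L2Unit => ‖x‖ ^ 2) (by fun_prop)
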